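/- Let $\mathcal X,\mathcal Y$ be finite sets. An interactive system is a map $(\mathcal X\times\mathcal Y)^*\times\mathcal X\to\Delta(\mathcal Y)$ that assigns to an interaction history and a next query the distribution of the next response; an adversary is a map $(\mathcal X\times\mathcal Y)^*\to\Delta(\mathcal X)$ that chooses the next query from the history. Two systems are $(\varepsilon,\delta)$-indistinguishable if for every adversary, every number of rounds $T$ and every set $S$ of transcripts, the probabilities $p_0,p_1$ that the $T$-round transcript with the first (second) system lies in $S$ satisfy $p_b\le e^{\varepsilon}p_{1-b}+\delta$ for $b=0,1$. An interactive mechanism $\mathcal M$ maps data sets $d$ to interactive systems $\mathcal M^d$; it is $(\varepsilon,\delta)$-DP if $\mathcal M^d,\mathcal M^{d'}$ are $(\varepsilon,\delta)$-indistinguishable for all neighbouring $d,d'$. The concurrent composition $\mathrm{COMP}(\mathcal M_1,\dots,\mathcal M_k)$ has queries $(i,x)\in[k]\times\mathcal X$; such a query is answered by $\mathcal M_i$ (run on the common data set) on the query $x$, given only the part of the history that was addressed to $\mathcal M_i$. So the adversary may interleave its queries arbitrarily. **Theorem 1.** Let $\varepsilon_1,\dots,\varepsilon_k\ge 0$ and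 $\delta_1,\dots,\delta_k\in[0,1]$, and let $\mathcal M_1,\dots,\mathcal M_k$ be interactive mechanisms that run on the same data set, $\mathcal M_i$ being $(\varepsilon_i,\delta_i)$-DP. Then $\mathrm{COMP}(\mathcal M_1,\dots,\mathcal M_k)$ is $(\varepsilon',\delta')$-DP for all $\varepsilon',\delta'$ given by the optimal sequential composition theorem, that is, whenever $$1-\delta'\ \le\ \prod_{i=1}^k(1-\delta_i)\left(1-\frac{\sum_{S\subseteq[k]}\max\left\{e^{\sum_{i\in S}\varepsilon_i}-e^{\varepsilon'}e^{\sum_{i\notin S}\varepsilon_i},\,0\right\}}{\prod_{i=1}^k(1+e^{\varepsilon_i})}\right).$$ This condition is optimal: it holds if and only if, for all non-interactive finite-valued mechanisms $N_1,\dots,N_k$ with $N_i$ being $(\varepsilon_i,\delta_i)$-DP, the mechanism that releases the results of $N_1,\dots,N_k$, run with independent coins on the same data set, is $(\varepsilon',\delta')$-DP. In particular, let all $\mathcal M_i$ be $(\varepsilon,\delta)$-DP with $\varepsilon\ge0$, $\delta\in[0,1]$, and let $\delta'\in(0,1)$. Then $\mathrm{COMP}(\mathcal M_1,\dots,\mathcal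 M_k)$ is $$\left(\sqrt{2k\log(1/\delta')}\,\varepsilon+k\varepsilon\,\frac{e^{\varepsilon}-1}{e^{\varepsilon}+1},\ k\delta+\delta'\right)\text{-DP}.$$ Hence it is $\left(O\!\left(\sqrt{k\log(1/\delta')}\,\varepsilon\right),k\delta+\delta'\right)$-DP in the regime $k\varepsilon^2=O(\log(1/\delta'))$: for every $c>0$ there is $C>0$, depending only on $c$, such that $k\varepsilon^2\le c\log(1/\delta')$ implies that it is $\left(C\sqrt{k\log(1/\delta')}\,\varepsilon,\ k\delta+\delta'\right)$-DP. -/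

import Mathlib

open scoped BigOperators

universe u v w

noncomputable section

namespace ConcurrentDP

/-- The probability that a sample of `p` lies in `S`, as a real number. -/
def prob {Ω : Type u} (p : PMF Ω) (S : Set Ω) : ℝ := (p.toOuterMeasure S).toReal

/-- `(ε, δ)`-closeness of two distributions, in both directions, over all events. -/
def Close {Ω : Type u} (ε δ : ℝ) (p q : PMF Ω) : Prop :=
  ∀ S : Set Ω,
    prob p S ≤ Real.exp ε * prob q S + δ ∧ prob q S ≤ Real.exp ε * prob p S + δ

/-- An interactive system with queries in `X` and responses in `Y`: given the interaction history
`(x₁, y₁), …, (xₜ, yₜ)` (in chronological order) and the next query, it returns the distribution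
of the next response. -/
abbrev InteractiveSystem (X : Type u) (Y : Type v) := List (X × Y) → X → PMF Y

/-- A (randomized) adversary: it chooses the next query from the interaction history. -/
abbrev Adversary (X : Type u) (Y : Type v) := List (X × Y) → PMF X

/-- The distribution of the transcript of the first `T` rounds of the interaction between the
adversary `A` and the system `M`; the adversary moves first. -/
def transcript {X : Type u} {Y : Type v} (A : Adversary X Y) (M : InteractiveSystem X Y) :
    ℕ → PMF (List (X × Y))
  | 0 => PMF.pure []
  | T + 1 =>
      (transcript A M T).bind fun h =>
        (A h).bind fun x =>
          (M h x).bind fun y => PMF.pure (h ++ [(x, y)])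

/-- `(ε, δ)`-indistinguishability of two interactive systems: for every adversary and every number
of rounds, the two transcripts are `(ε, δ)`-close. -/
def Indistinguishable {X : Type u} {Y : Type v} (ε δ : ℝ) (M₀ M₁ : InteractiveSystem X Y) : Prop :=
  ∀ (A : Adversary X Y) (T : ℕ), Close ε δ (transcript A M₀ T) (transcript A M₁ T)

/-- An interactive mechanism: a data set `d : D` induces the interactive system `M d`. -/
abbrev Mechanism (D : Type w) (X : Type u) (Y : Type v) := D → InteractiveSystem X Y

/-- `(ε, δ)`-differential privacy of an interactive mechanism, for the neighbouring relation
`adj` on data sets. -/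
def IsDP {D : Type w} {X : Type u} {Y : Type v} (adj : D → D → Prop) (ε δ : ℝ)
    (M : Mechanism D X Y) : Prop :=
  ∀ d d' : D, adj d d' → Indistinguishable ε δ (M d) (M d')

/-- The part of a history of the concurrent composition that the `i`-th system sees: the queries
addressed to `i` with their responses, in order. -/
def view {k : ℕ} {X : Type u} {Y : Type v} (i : Fin k) (h : List ((Fin k × X) × Y)) :
    List (X × Y) :=
  h.filterMap fun e => if e.1.1 = i then some (e.1.2, e.2) else none

/-- The concurrent composition of `k` interactive systems: the query `(i, x)` is answered by the
`i`-th system on the query `x`, on the basis of its own interaction only. -/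
def comp {k : ℕ} {X : Type u} {Y : Type v} (M : Fin k → InteractiveSystem X Y) :
    InteractiveSystem (Fin k × X) Y :=
  fun h q => M q.1 (view q.1 h) q.2

/-- The concurrent composition of `k` interactive mechanisms that run on the same data set. -/
def compMech {k : ℕ} {D : Type w} {X : Type u} {Y : Type v} (M : Fin k → Mechanism D X Y) :
    Mechanism D (Fin k × X) Y :=
  fun d => comp fun i => M i d

/-- The joint distribution of independent samples of `p 0, …, p (k - 1)`. -/
def prodPMF {k : ℕ} {R : Fin k → Type} [∀ i, Fintype (R i)] (p : ∀ i, PMF (R i)) :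
    PMF (∀ i, R i) :=
  PMF.ofFintype (fun r => ∏ i, p i (r i)) (by
    rw [← Fintype.prod_sum (fun i a => p i a)]
    refine Finset.prod_eq_one fun i _ => ?_
    rw [← tsum_fintype (L := SummationFilter.unconditional _)]
    exact (p i).tsum_coe)

/-- `(ε', δ')` is a valid bound for the sequential composition of mechanisms with parameters
`(ε i, δ i)`: whenever `N 0, …, N (k - 1)` are (non-interactive, finite-valued) mechanisms such that
`N i` is `(ε i, δ i)`-differentially private, releasing the results of all of them, run on the same
data set with independent coins, is `(ε', δ')`-differentially private. -/
def SequentialBound {k : ℕ} (ε δ : Fin k → ℝ) (ε' δ' : ℝ) : Prop :=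
  ∀ (D : Type) (adj : D → D → Prop) (R : Fin k → Type) [∀ i, Fintype (R i)]
    (N : ∀ i, D → PMF (R i)),
    (∀ i, ∀ d d' : D, adj d d' → Close (ε i) (δ i) (N i d) (N i d')) →
    ∀ d d' : D, adj d d' → Close ε' δ' (prodPMF fun i => N i d) (prodPMF fun i => N i d')

/-- The condition on `(ε', δ')` of the optimal (sequential) composition theorem,
`∏ᵢ (1 + e ^ εᵢ)⁻¹ · ∑_S max (e ^ (∑_{i ∈ S} εᵢ) - e ^ ε' · e ^ (∑_{i ∉ S} εᵢ)) 0`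
`≤ 1 - (1 - δ') / ∏ᵢ (1 - δᵢ)`, with denominators cleared so that `δᵢ = 1` is allowed. -/
def OptimalCondition {k : ℕ} (ε δ : Fin k → ℝ) (ε' δ' : ℝ) : Prop :=
  1 - δ' ≤ (∏ i, (1 - δ i)) *
    (1 - (∑ S : Finset (Fin k),
        max (Real.exp (∑ i ∈ S, ε i) - Real.exp ε' * Real.exp (∑ i ∈ Sᶜ, ε i)) 0) /
      ∏ i, (1 + Real.exp (ε i)))

end ConcurrentDP

end

open ConcurrentDP

noncomputable section

namespace ConcurrentDP

open Finset

/-! Everything reduces to randomized response, which reveals its input bit with probability `δ` and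
otherwise releases a noisy copy that is correct with odds `e ^ ε`. For `k` independent copies, the
best test between the inputs `true` and `false` can be computed by hand (`sum_min_rrCoeff`), and it
gives exactly `OptimalCondition`. Since randomized response is itself `(ε, δ)`-private, the
condition is necessary.

For sufficiency, every indistinguishable pair of systems is an interactive post-processing of
randomized response: up to `T` rounds, both likelihoods are mixtures of the same flows, with weights
`rrCoeff` (`Indistinguishable.exists_flows`). The likelihood of a concurrent composition is the
product of the likelihoods along the views, and the adversary contributes the same factor on both
sides. So `k` mixtures multiply out to one mixture over outcome tuples, whose components are flows
again, however the queries are interleaved; `OptimalCondition.mixture_le` concludes.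

To find the flows, let `capacity` be the least overlap `∑ min P (a * Q)`, `a = e ^ ε`, that a query
strategy can reach. The greedy adversary attains it, so it is at least `1 - δ`. Being defined node
by node, it allows mass `1 - δ` to be pushed down the tree of histories under all queries at once,
giving subflows of `P` and `Q` within a factor `a` of each other everywhere (`exists_subflows`).
These split linearly into the two noisy outcomes; the remainders, of mass `δ`, are the revealing
outcomes. -/

/-- The outcomes of randomized response: `Sum.inl b` reveals the input `b`, `Sum.inr b` is a noisy
version of it. -/
abbrev Outcome := Bool ⊕ Bool

/-- The probability of an outcome of `ε`-randomized response on the input `b`, conditioned on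
whether the input is revealed. -/
def rrCoeff (ε : ℝ) (b : Bool) : Outcome → ℝ
  | Sum.inl c => if c = b then 1 else 0
  | Sum.inr c => (if c = b then Real.exp ε else 1) / (1 + Real.exp ε)

/-- The probability that `(ε, δ)`-randomized response reveals its input or not. -/
def rrMass (δ : ℝ) : Outcome → ℝ
  | Sum.inl _ => δ
  | Sum.inr _ => 1 - δ

lemma rrCoeff_nonneg (ε : ℝ) (b : Bool) (j : Outcome) : 0 ≤ rrCoeff ε b j := by
  rcases j with c | c <;> simp only [rrCoeff] <;> split_ifs <;> positivity

lemma rrMass_nonneg {δ : ℝ} (h0 : 0 ≤ δ) (h1 : δ ≤ 1) (j : Outcome) : 0 ≤ rrMass δ j := by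
  rcases j with c | c <;> simp [rrMass, h0, h1]

lemma sum_rrCoeff_mul_rrMass (ε δ : ℝ) (b : Bool) :
    ∑ j, rrCoeff ε b j * rrMass δ j = 1 := by
  have : 1 + Real.exp ε ≠ 0 := by positivity
  cases b <;> simp [Fintype.sum_sum_type, rrCoeff, rrMass] <;> field_simp <;> ring

/-! ### The optimal condition as a test between randomized responses -/

section Product

variable {k : ℕ} (ε δ : Fin k → ℝ)

lemma sum_prod_rrCoeff_mul_prod_rrMass (b : Bool) :
    ∑ r : Fin k → Outcome, (∏ i, rrCoeff (ε i) b (r i)) * ∏ i, rrMass (δ i) (r i) = 1 := by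
  simp only [← prod_mul_distrib]
  rw [← Fintype.prod_sum (fun i j => rrCoeff (ε i) b j * rrMass (δ i) j)]
  exact prod_eq_one fun i _ => sum_rrCoeff_mul_rrMass _ _ _

lemma sum_exp_eq_prod :
    ∑ S : Finset (Fin k), Real.exp (∑ i ∈ S, ε i) = ∏ i, (1 + Real.exp (ε i)) := by
  rw [prod_one_add]
  simp [Real.exp_sum]

/-- The outcome of `k` instances of randomized response in which nothing is revealed and exactly
the bits in `S` are `true`. -/
def noisyOutcome (S : Finset (Fin k)) : Fin k → Outcome := fun i => Sum.inr (decide (i ∈ S))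

lemma noisyOutcome_injective : Function.Injective (noisyOutcome (k := k)) := by
  intro S T h
  ext i
  simpa [noisyOutcome] using congrFun h i

lemma exists_inl_of_notMem_range {r : Fin k → Outcome} (hr : r ∉ Set.range (noisyOutcome (k := k))) :
    ∃ i c, r i = Sum.inl c := by
  by_contra! h
  refine hr ⟨univ.filter fun i => r i = Sum.inr true, funext fun i => ?_⟩
  rcases hi : r i with c | c
  · exact absurd hi (h i c)
  · cases c <;> simp [noisyOutcome, hi]

lemma prod_rrCoeff_true_noisyOutcome (S : Finset (Fin k)) :
    ∏ i, rrCoeff (ε i) true (noisyOutcome S i) =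
      Real.exp (∑ i ∈ S, ε i) / ∏ i, (1 + Real.exp (ε i)) := by
  simp only [rrCoeff, noisyOutcome, prod_div_distrib, Real.exp_sum, decide_eq_true_eq]
  rw [prod_ite_mem, univ_inter]

lemma prod_rrCoeff_false_noisyOutcome (S : Finset (Fin k)) :
    ∏ i, rrCoeff (ε i) false (noisyOutcome S i) =
      Real.exp (∑ i ∈ Sᶜ, ε i) / ∏ i, (1 + Real.exp (ε i)) := by
  simp only [rrCoeff, noisyOutcome, prod_div_distrib, Real.exp_sum, decide_eq_false_iff_not,
    ← mem_compl]
  rw [prod_ite_mem, univ_inter]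

/-- A tuple with a revealed bit is impossible under the opposite input, so its minimum vanishes. The
other tuples are the `noisyOutcome S`, for which `min x y = x - max (x - y) 0` produces the sum over
`S`. -/
lemma sum_min_rrCoeff (ε' : ℝ) :
    ∑ r : Fin k → Outcome, min (∏ i, rrCoeff (ε i) true (r i))
        (Real.exp ε' * ∏ i, rrCoeff (ε i) false (r i)) * ∏ i, rrMass (δ i) (r i) =
      (∏ i, (1 - δ i)) * (1 - (∑ S : Finset (Fin k),
        max (Real.exp (∑ i ∈ S, ε i) - Real.exp ε' * Real.exp (∑ i ∈ Sᶜ, ε i)) 0) /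
      ∏ i, (1 + Real.exp (ε i))) := by
  have hpos : 0 < ∏ i, (1 + Real.exp (ε i)) := prod_pos fun i _ => by positivity
  rw [← Fintype.sum_of_injective noisyOutcome noisyOutcome_injective
    (fun S => (∏ i, (1 - δ i)) * ((Real.exp (∑ i ∈ S, ε i) -
      max (Real.exp (∑ i ∈ S, ε i) - Real.exp ε' * Real.exp (∑ i ∈ Sᶜ, ε i)) 0) /
        ∏ i, (1 + Real.exp (ε i)))) _ ?_ ?_]
  · rw [← mul_sum, ← sum_div, sum_sub_distrib, sum_exp_eq_prod, sub_div, div_self hpos.ne']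
  · intro r hr
    obtain ⟨i, c, hi⟩ := exists_inl_of_notMem_range hr
    have h0 : ∀ b, 0 ≤ ∏ i, rrCoeff (ε i) b (r i) :=
      fun b => prod_nonneg fun i _ => rrCoeff_nonneg _ _ _
    have hz : ∏ i, rrCoeff (ε i) (!c) (r i) = 0 :=
      prod_eq_zero (mem_univ i) (by cases c <;> simp [hi, rrCoeff])
    cases c
    · simp only [Bool.not_false] at hz
      rw [hz, min_eq_left (mul_nonneg (Real.exp_pos _).le (h0 _)), zero_mul]
    · simp only [Bool.not_true] at hz
      rw [hz, mul_zero, min_eq_right (h0 _), zero_mul]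
  · intro S
    rw [prod_rrCoeff_true_noisyOutcome, prod_rrCoeff_false_noisyOutcome, mul_comm]
    congr 1
    rw [← mul_div_assoc, min_div_div_right hpos.le]
    congr 1
    rcases le_total (Real.exp (∑ i ∈ S, ε i)) (Real.exp ε' * Real.exp (∑ i ∈ Sᶜ, ε i)) with h | h
    · rw [min_eq_left h, max_eq_right (by linarith)]; ring
    · rw [min_eq_right h, max_eq_left (by linarith)]; ring

lemma optimalCondition_iff (ε' δ' : ℝ) :
    OptimalCondition ε δ ε' δ' ↔
      1 - δ' ≤ ∑ r : Fin k → Outcome, min (∏ i, rrCoeff (ε i) true (r i))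
        (Real.exp ε' * ∏ i, rrCoeff (ε i) false (r i)) * ∏ i, rrMass (δ i) (r i) := by
  rw [sum_min_rrCoeff ε δ, OptimalCondition]

variable {ε δ}

/-- Mixtures over the outcomes of `k` instances of randomized response satisfy the optimal
composition bound. -/
lemma OptimalCondition.mixture_le {ε' δ' : ℝ}
    (h : OptimalCondition ε δ ε' δ') {G : (Fin k → Outcome) → ℝ} (hG0 : ∀ r, 0 ≤ G r)
    (hG : ∀ r, G r ≤ ∏ i, rrMass (δ i) (r i)) :
    ∑ r, (∏ i, rrCoeff (ε i) true (r i)) * G r ≤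
      Real.exp ε' * ∑ r, (∏ i, rrCoeff (ε i) false (r i)) * G r + δ' := by
  rw [optimalCondition_iff ε δ] at h
  have h1 := sum_prod_rrCoeff_mul_prod_rrMass ε δ true
  -- Termwise, `(u - v) * G ≤ (u - min u v) * m` whenever `0 ≤ G ≤ m`; the weights `u * m` sum to
  -- one.
  suffices ∑ r, (∏ i, rrCoeff (ε i) true (r i)) * G r
      - Real.exp ε' * ∑ r, (∏ i, rrCoeff (ε i) false (r i)) * G r ≤
      ∑ r : Fin k → Outcome, (∏ i, rrCoeff (ε i) true (r i)) * ∏ i, rrMass (δ i) (r i) -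
      ∑ r : Fin k → Outcome, min (∏ i, rrCoeff (ε i) true (r i))
        (Real.exp ε' * ∏ i, rrCoeff (ε i) false (r i)) * ∏ i, rrMass (δ i) (r i) by linarith
  rw [mul_sum, ← sum_sub_distrib, ← sum_sub_distrib]
  refine sum_le_sum fun r _ => ?_
  have hg := hG r
  have hg0 := hG0 r
  rcases le_total (∏ i, rrCoeff (ε i) true (r i))
    (Real.exp ε' * ∏ i, rrCoeff (ε i) false (r i)) with hc | hc
  · rw [min_eq_left hc]
    nlinarith
  · rw [min_eq_right hc]
    nlinarith

end Product

/-! ### Splitting a pair of masses -/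

lemma exists_mem_unit_mul_eq {p S : ℝ} (h0 : 0 ≤ p) (h1 : p ≤ S) :
    ∃ μ, 0 ≤ μ ∧ μ ≤ 1 ∧ μ * S = p := by
  rcases (h0.trans h1).eq_or_lt with hS | hS
  · exact ⟨0, le_rfl, zero_le_one, by linarith⟩
  · exact ⟨p / S, by positivity, (div_le_one hS).2 h1, div_mul_cancel₀ _ hS.ne'⟩

/-- Take `f = μ * s`. The functions `μ * s / a` and `μ * t` both meet every constraint on `g`, their
totals enclose `q`, and the constraints are convex, so `g` can be interpolated between them. -/
lemma exists_split_of_le {Y : Type*} [Fintype Y] {a : ℝ} (ha : 1 ≤ a) {s t : Y → ℝ}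
    (hs : ∀ y, 0 ≤ s y) (hst : ∀ y, s y ≤ a * t y) (hts : ∀ y, t y ≤ a * s y)
    {μ q : ℝ} (hμ0 : 0 ≤ μ) (hμ1 : μ ≤ 1) (hq : q ≤ μ * ∑ y, t y) (hpq : μ * ∑ y, s y ≤ a * q) :
    ∃ f g : Y → ℝ, ∑ y, f y = μ * ∑ y, s y ∧ ∑ y, g y = q ∧
      ∀ y, 0 ≤ f y ∧ 0 ≤ g y ∧ f y ≤ s y ∧ g y ≤ t y ∧ f y ≤ a * g y ∧ g y ≤ a * f y := by
  have ha0 : 0 < a := by linarith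
  obtain ⟨θ, hθ0, hθ1, hθ⟩ := exists_mem_unit_mul_eq
    (p := q - μ * (∑ y, s y) / a) (S := μ * (∑ y, t y) - μ * (∑ y, s y) / a)
    (by rw [sub_nonneg, div_le_iff₀ ha0]; linarith) (by linarith)
  refine ⟨fun y => μ * s y, fun y => (1 - θ) * μ * (s y / a) + θ * μ * t y, ?_, ?_, fun y => ?_⟩
  · rw [mul_sum]
  · rw [sum_add_distrib, ← mul_sum, ← mul_sum, ← sum_div]
    linear_combination hθ
  · have hsy : s y / a ≤ t y := (div_le_iff₀' ha0).2 (hst y)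
    have hsa : s y / a ≤ a * s y := by
      rw [div_le_iff₀ ha0]; nlinarith [hs y, mul_nonneg (hs y) (by nlinarith : 0 ≤ a * a - 1)]
    have hs0 : 0 ≤ s y / a := div_nonneg (hs y) ha0.le
    have ht0 : 0 ≤ t y := hs0.trans hsy
    have h1 : 0 ≤ (1 - θ) * μ := mul_nonneg (by linarith) hμ0
    have h2 : 0 ≤ θ * μ := mul_nonneg hθ0 hμ0
    have e : a * (s y / a) = s y := mul_div_cancel₀ _ ha0.ne'
    refine ⟨mul_nonneg hμ0 (hs y), by positivity, by nlinarith [hs y], ?_, ?_, ?_⟩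
    · nlinarith [mul_le_mul_of_nonneg_left hsy h1]
    · have : a * ((1 - θ) * μ * (s y / a) + θ * μ * t y)
          = (1 - θ) * μ * s y + θ * μ * (a * t y) := by
        linear_combination (1 - θ) * μ * e
      rw [this]
      nlinarith [mul_le_mul_of_nonneg_left (hst y) h2]
    · nlinarith [mul_le_mul_of_nonneg_left hsa h1, mul_le_mul_of_nonneg_left (hts y) h2]

/-- A pair of masses within a factor `a` of each other, and bounded by the total capacities, can
be distributed within the capacities so that all parts are within a factor `a` of each other. -/
lemma exists_split {Y : Type*} [Fintype Y] {a : ℝ} (ha : 1 ≤ a) {s t : Y → ℝ}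
    (hs : ∀ y, 0 ≤ s y) (ht : ∀ y, 0 ≤ t y)
    (hst : ∀ y, s y ≤ a * t y) (hts : ∀ y, t y ≤ a * s y)
    {p q : ℝ} (hp0 : 0 ≤ p) (hq0 : 0 ≤ q) (hp : p ≤ ∑ y, s y) (hq : q ≤ ∑ y, t y)
    (hpq : p ≤ a * q) (hqp : q ≤ a * p) :
    ∃ f g : Y → ℝ, ∑ y, f y = p ∧ ∑ y, g y = q ∧
      ∀ y, 0 ≤ f y ∧ 0 ≤ g y ∧ f y ≤ s y ∧ g y ≤ t y ∧ f y ≤ a * g y ∧ g y ≤ a * f y := by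
  obtain ⟨μ, hμ0, hμ1, rfl⟩ := exists_mem_unit_mul_eq hp0 hp
  obtain ⟨ν, hν0, hν1, rfl⟩ := exists_mem_unit_mul_eq hq0 hq
  -- The side using the larger fraction of its capacity is scaled uniformly, and the other is fitted
  -- to it.
  rcases le_total ν μ with h | h
  · exact exists_split_of_le ha hs hst hts hμ0 hμ1
      (mul_le_mul_of_nonneg_right h (sum_nonneg fun y _ => ht y)) hpq
  · obtain ⟨g, f, hg, hf, H⟩ := exists_split_of_le ha ht hts hst hν0 hν1
      (mul_le_mul_of_nonneg_right h (sum_nonneg fun y _ => hs y)) hqp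
    exact ⟨f, g, hf, hg, fun y =>
      let ⟨h1, h2, h3, h4, h5, h6⟩ := H y
      ⟨h2, h1, h4, h3, h6, h5⟩⟩

/-! ### Decomposition into the outcomes of randomized response -/

/-- For masses `P`, `Q` with parts `p`, `q` that are within a bounded factor of each other, the mass
of each outcome of randomized response; `α`, `β` are chosen by `exists_rrParts_weights`. -/
def rrParts (α β P Q p q : ℝ) : Outcome → ℝ
  | Sum.inl true => P - p
  | Sum.inl false => Q - q
  | Sum.inr true => α * p + β * q
  | Sum.inr false => α * q + β * p

/-- Solves `(1 + a) p = a u + v`, `(1 + a) q = u + a v` for `u = (a p - q) / (a - 1)`, nonnegative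
as `q ≤ a p`; `v` is symmetric. For `a = 1` the system is singular, but then `p = q`. -/
lemma exists_rrParts_weights {a : ℝ} (ha : 1 ≤ a) : ∃ α β : ℝ, α + β = 1 ∧
    ∀ p q, 0 ≤ p → 0 ≤ q → p ≤ a * q → q ≤ a * p →
      0 ≤ α * p + β * q ∧ a * (α * p + β * q) + (α * q + β * p) = (1 + a) * p := by
  rcases ha.eq_or_lt with rfl | ha
  · refine ⟨1, 0, by norm_num, fun p q hp hq h1 h2 => ⟨by linarith, by linarith⟩⟩
  · have h : 0 < a - 1 := by linarith
    refine ⟨a / (a - 1), -1 / (a - 1), by field_simp; ring, fun p q hp hq h1 h2 => ⟨?_, ?_⟩⟩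
    · have : a / (a - 1) * p + -1 / (a - 1) * q = (a * p - q) / (a - 1) := by field_simp; ring
      rw [this]
      exact div_nonneg (by linarith) h.le
    · field_simp
      ring

lemma sum_rrParts {Y : Type*} [Fintype Y] (α β : ℝ) (P Q p q : Y → ℝ) (j : Outcome) :
    ∑ y, rrParts α β (P y) (Q y) (p y) (q y) j =
      rrParts α β (∑ y, P y) (∑ y, Q y) (∑ y, p y) (∑ y, q y) j := by
  rcases j with (_ | _) | (_ | _) <;> simp [rrParts, sum_sub_distrib, sum_add_distrib, mul_sum]

lemma rrParts_one {α β : ℝ} (h : α + β = 1) (δ : ℝ) (j : Outcome) :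
    rrParts α β 1 1 (1 - δ) (1 - δ) j = rrMass δ j := by
  rcases j with (_ | _) | (_ | _) <;> simp only [rrParts, rrMass]
  · ring
  · ring
  · linear_combination (1 - δ) * h
  · linear_combination (1 - δ) * h

lemma rrParts_nonneg {a α β : ℝ}
    (h : ∀ p q, 0 ≤ p → 0 ≤ q → p ≤ a * q → q ≤ a * p →
      0 ≤ α * p + β * q ∧ a * (α * p + β * q) + (α * q + β * p) = (1 + a) * p)
    {P Q p q : ℝ} (hp0 : 0 ≤ p) (hq0 : 0 ≤ q) (hpP : p ≤ P) (hqQ : q ≤ Q)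
    (hpq : p ≤ a * q) (hqp : q ≤ a * p) (j : Outcome) : 0 ≤ rrParts α β P Q p q j := by
  rcases j with (_ | _) | (_ | _)
  · exact sub_nonneg.2 hqQ
  · exact sub_nonneg.2 hpP
  · exact (h q p hq0 hp0 hqp hpq).1
  · exact (h p q hp0 hq0 hpq hqp).1

lemma sum_rrCoeff_mul_rrParts {ε α β : ℝ}
    (h : ∀ p q, 0 ≤ p → 0 ≤ q → p ≤ Real.exp ε * q → q ≤ Real.exp ε * p →
      0 ≤ α * p + β * q ∧ Real.exp ε * (α * p + β * q) + (α * q + β * p) = (1 + Real.exp ε) * p)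
    {P Q p q : ℝ} (hp0 : 0 ≤ p) (hq0 : 0 ≤ q)
    (hpq : p ≤ Real.exp ε * q) (hqp : q ≤ Real.exp ε * p) :
    ∑ j, rrCoeff ε true j * rrParts α β P Q p q j = P ∧
      ∑ j, rrCoeff ε false j * rrParts α β P Q p q j = Q := by
  have h0 : 1 + Real.exp ε ≠ 0 := by positivity
  have h1 := (h p q hp0 hq0 hpq hqp).2
  have h2 := (h q p hq0 hp0 hqp hpq).2
  constructor <;> simp [Fintype.sum_sum_type, rrCoeff, rrParts] <;> field_simp <;> linarith

/-! ### Probabilities as finite sums -/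

lemma prob_nonneg {Ω : Type*} (p : PMF Ω) (S : Set Ω) : 0 ≤ prob p S := ENNReal.toReal_nonneg

lemma prob_eq_sum {Ω : Type*} (p : PMF Ω) (s : Finset Ω) (hs : ∀ x ∉ s, p x = 0) (S : Set Ω)
    [DecidablePred (· ∈ S)] : prob p S = ∑ x ∈ s with x ∈ S, (p x).toReal := by
  classical
  rw [prob, PMF.toOuterMeasure_apply, tsum_eq_sum (s := s), ENNReal.toReal_sum]
  · rw [sum_filter]
    refine sum_congr rfl fun x _ => ?_
    by_cases h : x ∈ S <;> simp [h]
  · intro x _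
    by_cases h : x ∈ S <;> simp [h, p.apply_ne_top x]
  · intro x hx
    by_cases h : x ∈ S <;> simp [h, hs x hx]

lemma prob_eq_sum_fintype {Ω : Type*} [Fintype Ω] (p : PMF Ω) (S : Set Ω)
    [DecidablePred (· ∈ S)] : prob p S = ∑ x with x ∈ S, (p x).toReal :=
  prob_eq_sum p univ (fun x hx => absurd (mem_univ x) hx) S

lemma sum_toReal_eq_one {Ω : Type*} [Fintype Ω] (p : PMF Ω) : ∑ x, (p x).toReal = 1 := by
  rw [← ENNReal.toReal_sum fun x _ => p.apply_ne_top x, ← tsum_fintype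
    (L := SummationFilter.unconditional _), p.tsum_coe, ENNReal.toReal_one]

/-! ### Likelihoods -/

/-- The product of the conditional weights `w` along a list, after the prefix `pre`. -/
def stepProdFrom {E : Type*} (w : List E → E → ℝ) : List E → List E → ℝ
  | _, [] => 1
  | pre, e :: l => w pre e * stepProdFrom w (pre ++ [e]) l

/-- The product of the conditional weights `w` along a list. -/
def stepProd {E : Type*} (w : List E → E → ℝ) (l : List E) : ℝ := stepProdFrom w [] l

lemma stepProdFrom_append {E : Type*} (w : List E → E → ℝ) (pre l : List E) (e : E) :
    stepProdFrom w pre (l ++ [e]) = stepProdFrom w pre l * w (pre ++ l) e := by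
  induction l generalizing pre with
  | nil => simp [stepProdFrom]
  | cons e' l ih => simp [stepProdFrom, ih, mul_assoc]

@[simp] lemma stepProd_nil {E : Type*} (w : List E → E → ℝ) : stepProd w [] = 1 := rfl

lemma stepProd_append {E : Type*} (w : List E → E → ℝ) (l : List E) (e : E) :
    stepProd w (l ++ [e]) = stepProd w l * w l e := by
  simpa [stepProd] using stepProdFrom_append w [] l e

lemma stepProd_nonneg {E : Type*} {w : List E → E → ℝ} (hw : ∀ l e, 0 ≤ w l e) (l : List E) :
    0 ≤ stepProd w l := by
  induction l using List.reverseRecOn with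
  | nil => simp
  | append_singleton l e ih => rw [stepProd_append]; exact mul_nonneg ih (hw l e)

section Systems

variable {X : Type u} {Y : Type v}

/-- The probability that the system gives the responses in the history, given the queries. -/
def likelihood (M : InteractiveSystem X Y) (h : List (X × Y)) : ℝ :=
  stepProd (fun l e => (M l e.1 e.2).toReal) h

/-- The probability that the adversary asks the queries in the history, given the responses. -/
def advLikelihood (A : Adversary X Y) (h : List (X × Y)) : ℝ :=
  stepProd (fun l e => (A l e.1).toReal) h

@[simp] lemma likelihood_nil (M : InteractiveSystem X Y) : likelihood M [] = 1 := rfl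

@[simp] lemma advLikelihood_nil (A : Adversary X Y) : advLikelihood A [] = 1 := rfl

lemma likelihood_append (M : InteractiveSystem X Y) (h : List (X × Y)) (e : X × Y) :
    likelihood M (h ++ [e]) = likelihood M h * (M h e.1 e.2).toReal := stepProd_append _ _ _

lemma advLikelihood_append (A : Adversary X Y) (h : List (X × Y)) (e : X × Y) :
    advLikelihood A (h ++ [e]) = advLikelihood A h * (A h e.1).toReal := stepProd_append _ _ _

lemma likelihood_nonneg (M : InteractiveSystem X Y) (h : List (X × Y)) : 0 ≤ likelihood M h :=
  stepProd_nonneg (fun _ _ => ENNReal.toReal_nonneg) h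

lemma advLikelihood_nonneg (A : Adversary X Y) (h : List (X × Y)) : 0 ≤ advLikelihood A h :=
  stepProd_nonneg (fun _ _ => ENNReal.toReal_nonneg) h

lemma transcript_succ_apply_append (A : Adversary X Y) (M : InteractiveSystem X Y) (T : ℕ)
    (h : List (X × Y)) (x : X) (y : Y) :
    transcript A M (T + 1) (h ++ [(x, y)]) = transcript A M T h * (A h x * M h x y) := by
  classical
  rw [transcript, PMF.bind_apply, tsum_eq_single h]
  · congr 1
    rw [PMF.bind_apply, tsum_eq_single x]
    · congr 1
      rw [PMF.bind_apply, tsum_eq_single y]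
      · simp
      · intro y' hy'
        simp [PMF.pure_apply, hy'.symm]
    · intro x' hx'
      simp [PMF.bind_apply, PMF.pure_apply, hx'.symm]
  · intro h' hh'
    have : ∀ e e' : X × Y, h ++ [e] ≠ h' ++ [e'] := fun e e' H => hh' (by simp_all)
    simp [PMF.bind_apply, PMF.pure_apply, this]

lemma transcript_succ_apply_nil (A : Adversary X Y) (M : InteractiveSystem X Y) (T : ℕ) :
    transcript A M (T + 1) [] = 0 := by
  classical
  simp [transcript, PMF.bind_apply, PMF.pure_apply]

lemma transcript_apply_of_length_ne (A : Adversary X Y) (M : InteractiveSystem X Y) (T : ℕ)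
    (h : List (X × Y)) (hT : h.length ≠ T) : transcript A M T h = 0 := by
  classical
  induction T generalizing h with
  | zero =>
    have : h ≠ [] := fun H => hT (by simp [H])
    simp [transcript, PMF.pure_apply, this]
  | succ T ih =>
    rcases h.eq_nil_or_concat with rfl | ⟨h, e, rfl⟩
    · exact transcript_succ_apply_nil A M T
    · simp only [List.concat_eq_append] at *
      rw [transcript_succ_apply_append, ih h (by simpa using hT), zero_mul]

lemma toReal_transcript_apply (A : Adversary X Y) (M : InteractiveSystem X Y)
    (h : List (X × Y)) :
    (transcript A M h.length h).toReal = advLikelihood A h * likelihood M h := by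
  classical
  induction h using List.reverseRecOn with
  | nil => simp [transcript]
  | append_singleton h e ih =>
    rw [List.length_append, List.length_singleton, transcript_succ_apply_append,
      ENNReal.toReal_mul, ENNReal.toReal_mul, ih, advLikelihood_append, likelihood_append]
    ring

variable [Fintype Y]

/-! ### Flows -/

/-- `F` assigns a nonnegative mass to every history of length at most `T`, such that for every next
query, the mass of a history is distributed among its extensions by the possible responses. -/
structure IsFlow (T : ℕ) (F : List (X × Y) → ℝ) : Prop where
  nonneg : ∀ h, h.length ≤ T → 0 ≤ F h
  sum_append : ∀ h, h.length < T → ∀ x, ∑ y, F (h ++ [(x, y)]) = F h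

lemma isFlow_likelihood (M : InteractiveSystem X Y) (T : ℕ) : IsFlow T (likelihood M) where
  nonneg h _ := likelihood_nonneg M h
  sum_append h _ x := by
    simp only [likelihood_append, ← mul_sum]
    rw [sum_toReal_eq_one, mul_one]

/-- The smallest, over all query strategies for the next `n` rounds after the history, total of
`min (P h) (a * Q h)` over the outcomes `h`. -/
def capacity (a : ℝ) (P Q : List (X × Y) → ℝ) : ℕ → List (X × Y) → ℝ
  | 0, h => min (P h) (a * Q h)
  | n + 1, h => ⨅ x : X, ∑ y, capacity a P Q n (h ++ [(x, y)])

variable {a : ℝ} {P Q : List (X × Y) → ℝ}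

lemma capacity_nonneg [Nonempty X] {T : ℕ} (ha : 0 ≤ a) (hP : IsFlow T P) (hQ : IsFlow T Q) (n : ℕ)
    (h : List (X × Y)) (hT : h.length + n ≤ T) : 0 ≤ capacity a P Q n h := by
  induction n generalizing h with
  | zero => exact le_min (hP.nonneg h hT) (mul_nonneg ha (hQ.nonneg h hT))
  | succ n ih =>
    exact le_ciInf fun x => sum_nonneg fun y _ => ih _ (by simp; omega)

variable [Fintype X]

/-- The histories of a given length. -/
def histories (X : Type u) (Y : Type v) [Fintype X] [Fintype Y] (T : ℕ) :
    Finset (List (X × Y)) := (List.finite_length_eq (X × Y) T).toFinset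

lemma mem_histories {T : ℕ} {h : List (X × Y)} : h ∈ histories X Y T ↔ h.length = T := by
  simp [histories]

lemma sum_histories_zero (φ : List (X × Y) → ℝ) : ∑ h ∈ histories X Y 0, φ h = φ [] := by
  have : histories X Y 0 = {[]} := by
    ext h; simp [mem_histories]
  rw [this, sum_singleton]

lemma sum_histories_succ (T : ℕ) (φ : List (X × Y) → ℝ) :
    ∑ h ∈ histories X Y (T + 1), φ h =
      ∑ h ∈ histories X Y T, ∑ x, ∑ y, φ (h ++ [(x, y)]) := by
  classical
  simp_rw [← Fintype.sum_prod_type' (f := fun x y => φ (_ ++ [(x, y)])), Prod.mk.eta]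
  rw [← sum_product' (histories X Y T) univ (fun h e => φ (h ++ [e]))]
  symm
  refine sum_bij (fun a _ => a.1 ++ [a.2]) ?_ ?_ ?_ fun _ _ => rfl
  · rintro ⟨h, e⟩ ha
    simpa [mem_histories] using ha
  · rintro ⟨h, e⟩ _ ⟨h', e'⟩ _ H
    simpa using H
  · intro h hh
    rcases h.eq_nil_or_concat with rfl | ⟨h, e, rfl⟩
    · simp [mem_histories] at hh
    · exact ⟨(h, e), by simpa [mem_histories] using hh, by simp⟩

lemma prob_transcript (A : Adversary X Y) (M : InteractiveSystem X Y) (T : ℕ)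
    (S : Set (List (X × Y))) [DecidablePred (· ∈ S)] :
    prob (transcript A M T) S =
      ∑ h ∈ histories X Y T with h ∈ S, advLikelihood A h * likelihood M h := by
  rw [prob_eq_sum _ (histories X Y T) fun h hh =>
    transcript_apply_of_length_ne A M T h (mem_histories.not.1 hh)]
  refine sum_congr rfl fun h hh => ?_
  rw [← toReal_transcript_apply, mem_histories.1 (mem_filter.1 hh).1]

/-- If an adversary weighs the histories against a family of masses that is, on average over its
next query, consistent, then the total mass is that of the empty history. -/
lemma sum_advLikelihood_mul_eq (A : Adversary X Y) (T : ℕ) (F : List (X × Y) → ℝ)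
    (hF : ∀ h, h.length < T → ∑ x, (A h x).toReal * ∑ y, F (h ++ [(x, y)]) = F h) :
    ∑ h ∈ histories X Y T, advLikelihood A h * F h = F [] := by
  suffices ∀ n ≤ T, ∑ h ∈ histories X Y n, advLikelihood A h * F h = F [] from this T le_rfl
  intro n hn
  induction n with
  | zero => simp [sum_histories_zero]
  | succ n ih =>
    rw [← ih (by omega), sum_histories_succ]
    refine sum_congr rfl fun h hh => ?_
    rw [mem_histories] at hh
    rw [← hF h (by omega), mul_sum]
    refine sum_congr rfl fun x _ => ?_
    simp only [advLikelihood_append]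
    rw [mul_sum, mul_sum]
    exact sum_congr rfl fun y _ => by ring

lemma IsFlow.sum_advLikelihood_mul {T : ℕ} {F : List (X × Y) → ℝ} (hF : IsFlow T F)
    (A : Adversary X Y) : ∑ h ∈ histories X Y T, advLikelihood A h * F h = F [] := by
  refine sum_advLikelihood_mul_eq A T F fun h hh => ?_
  simp only [hF.sum_append h hh]
  rw [← sum_mul, sum_toReal_eq_one, one_mul]

/-! ### The greedy adversary -/

lemma capacity_succ_le (a : ℝ) (P Q : List (X × Y) → ℝ) (n : ℕ) (h : List (X × Y)) (x : X) :
    capacity a P Q (n + 1) h ≤ ∑ y, capacity a P Q n (h ++ [(x, y)]) :=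
  ciInf_le (Set.finite_range _).bddBelow x

variable [Nonempty X]

lemma exists_capacity_succ_eq (a : ℝ) (P Q : List (X × Y) → ℝ) (n : ℕ) (h : List (X × Y)) :
    ∃ x, ∑ y, capacity a P Q n (h ++ [(x, y)]) = capacity a P Q (n + 1) h :=
  exists_eq_ciInf_of_finite

lemma capacity_le {T : ℕ} (hP : IsFlow T P) (n : ℕ) (h : List (X × Y))
    (hT : h.length + n ≤ T) : capacity a P Q n h ≤ P h := by
  induction n generalizing h with
  | zero => exact min_le_left _ _
  | succ n ih =>
    obtain ⟨x⟩ := ‹Nonempty X›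
    rw [← hP.sum_append h (by omega) x]
    exact (capacity_succ_le a P Q n h x).trans (sum_le_sum fun y _ => ih _ (by simp; omega))

/-- True at the leaves because `a ≥ 1`. It propagates upwards since the query that is optimal for
the right side is a competitor on the left. -/
lemma capacity_le_mul_capacity {T : ℕ} (ha : 1 ≤ a) (hP : IsFlow T P) (n : ℕ)
    (h : List (X × Y)) (hT : h.length + n ≤ T) : capacity a P Q n h ≤ a * capacity a Q P n h := by
  induction n generalizing h with
  | zero =>
    have hp := hP.nonneg h hT
    simp only [capacity, mul_min_of_nonneg _ _ (zero_le_one.trans ha)]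
    refine le_min (min_le_right _ _) ((min_le_left _ _).trans ?_)
    nlinarith [mul_nonneg (sub_nonneg.2 ha) hp, mul_nonneg (sub_nonneg.2 ha)
      (mul_nonneg (zero_le_one.trans ha) hp)]
  | succ n ih =>
    obtain ⟨x, hx⟩ := exists_capacity_succ_eq a Q P n h
    rw [← hx, mul_sum]
    exact (capacity_succ_le a P Q n h x).trans (sum_le_sum fun y _ => ih _ (by simp; omega))

/-- The adversary that always asks a query minimizing the remaining capacity. -/
def greedyAdversary (a : ℝ) (P Q : List (X × Y) → ℝ) (T : ℕ) : Adversary X Y := fun h =>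
  PMF.pure (exists_capacity_succ_eq a P Q (T - (h.length + 1)) h).choose

lemma sum_greedyAdversary (a : ℝ) (P Q : List (X × Y) → ℝ) (T : ℕ) :
    ∑ h ∈ histories X Y T, advLikelihood (greedyAdversary a P Q T) h * min (P h) (a * Q h) =
      capacity a P Q T [] := by
  classical
  have := sum_advLikelihood_mul_eq (greedyAdversary a P Q T) T
    (fun h => capacity a P Q (T - h.length) h) fun h hh => by
      have hx := (exists_capacity_succ_eq a P Q (T - (h.length + 1)) h).choose_spec
      -- After the query chosen at `h`, `T - (h.length + 1)` rounds remain; `hh` makes the truncated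
      -- subtraction exact.
      have e : T - h.length = T - (h.length + 1) + 1 := by omega
      rw [sum_eq_single (exists_capacity_succ_eq a P Q (T - (h.length + 1)) h).choose]
      · rw [e]
        refine Eq.trans ?_ hx
        simp [greedyAdversary]
      · intro x _ hne
        simp [greedyAdversary, PMF.pure_apply, hne]
      · simp
  simp only [List.length_nil, Nat.sub_zero] at this
  rw [← this]
  refine sum_congr rfl fun h hh => ?_
  rw [mem_histories.1 hh, Nat.sub_self, capacity]

/-- The best distinguisher sees no more than `δ`, so at least `1 - δ` is left. -/
lemma one_sub_le_capacity {ε δ : ℝ} {M₀ M₁ : InteractiveSystem X Y} {T : ℕ}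
    (h : ∀ (A : Adversary X Y) (S : Set (List (X × Y))),
      prob (transcript A M₀ T) S ≤ Real.exp ε * prob (transcript A M₁ T) S + δ) :
    1 - δ ≤ capacity (Real.exp ε) (likelihood M₀) (likelihood M₁) T [] := by
  classical
  set A := greedyAdversary (Real.exp ε) (likelihood M₀) (likelihood M₁) T with hA
  -- The likelihood ratio test: on this event `P - a * Q` equals `P - min P (a * Q)`, and off it the
  -- latter vanishes.
  have h1 := h A {h | Real.exp ε * likelihood M₁ h ≤ likelihood M₀ h}
  rw [← sum_greedyAdversary, ← hA]
  have h2 := (isFlow_likelihood M₀ T).sum_advLikelihood_mul A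
  rw [likelihood_nil] at h2
  rw [prob_transcript, prob_transcript] at h1
  simp only [Set.mem_ofPred_eq, sum_filter, mul_sum] at h1
  rw [← h2]
  suffices ∑ h ∈ histories X Y T, advLikelihood A h * likelihood M₀ h -
      ∑ h ∈ histories X Y T,
        advLikelihood A h * min (likelihood M₀ h) (Real.exp ε * likelihood M₁ h) ≤ δ by linarith
  refine le_trans (le_of_eq ?_) (sub_le_iff_le_add'.2 h1)
  rw [← sum_sub_distrib, ← sum_sub_distrib]
  refine sum_congr rfl fun h _ => ?_
  split_ifs with hc
  · rw [min_eq_right hc]; ring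
  · rw [min_eq_left (not_le.1 hc).le]; ring

/-! ### Subflows that are close everywhere -/

/-- Induction on the remaining rounds, with the capacities as the invariant that keeps later splits
feasible. -/
lemma exists_subflows {T : ℕ} (ha : 1 ≤ a) (hP : IsFlow T P) (hQ : IsFlow T Q) (n : ℕ)
    (h : List (X × Y)) (hT : h.length + n ≤ T) {p q : ℝ} (hp0 : 0 ≤ p) (hq0 : 0 ≤ q)
    (hp : p ≤ capacity a P Q n h) (hq : q ≤ capacity a Q P n h)
    (hpq : p ≤ a * q) (hqp : q ≤ a * p) :
    ∃ f g : List (X × Y) → ℝ, f [] = p ∧ g [] = q ∧ IsFlow n f ∧ IsFlow n g ∧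
      ∀ l, l.length ≤ n → f l ≤ P (h ++ l) ∧ g l ≤ Q (h ++ l) ∧ f l ≤ a * g l ∧ g l ≤ a * f l := by
  induction n generalizing h p q with
  | zero =>
    refine ⟨fun _ => p, fun _ => q, rfl, rfl, ⟨fun _ _ => hp0, by simp⟩, ⟨fun _ _ => hq0, by simp⟩,
      fun l hl => ?_⟩
    obtain rfl : l = [] := by simpa using hl
    rw [List.append_nil]
    exact ⟨hp.trans (capacity_le hP 0 h hT), hq.trans (capacity_le hQ 0 h hT), hpq, hqp⟩
  | succ n ih =>
    have ha0 : 0 ≤ a := zero_le_one.trans ha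
    have hlen : ∀ x y, (h ++ [(x, y)]).length + n ≤ T := fun x y => by simp; omega
    -- Each query is split separately: the capacity at `h` is at most the total capacity after `x`,
    -- for every `x`.
    have hsplit := fun x : X => exists_split ha
      (s := fun y => capacity a P Q n (h ++ [(x, y)]))
      (t := fun y => capacity a Q P n (h ++ [(x, y)]))
      (fun y => capacity_nonneg ha0 hP hQ n _ (hlen x y))
      (fun y => capacity_nonneg ha0 hQ hP n _ (hlen x y))
      (fun y => capacity_le_mul_capacity ha hP n _ (hlen x y))
      (fun y => capacity_le_mul_capacity ha hQ n _ (hlen x y))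
      hp0 hq0 (hp.trans (capacity_succ_le a P Q n h x)) (hq.trans (capacity_succ_le a Q P n h x))
      hpq hqp
    choose p' q' hp' hq' H using hsplit
    have hrec := fun x y => ih (h ++ [(x, y)]) (hlen x y) (H x y).1 (H x y).2.1 (H x y).2.2.1
      (H x y).2.2.2.1 (H x y).2.2.2.2.1 (H x y).2.2.2.2.2
    choose f g hf hg hfF hgF hb using hrec
    -- Gluing the flows on the subtrees below a common root of mass `p`.
    have key : ∀ (f : X → Y → List (X × Y) → ℝ) (p' : X → Y → ℝ) (p : ℝ), 0 ≤ p →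
        (∀ x, ∑ y, p' x y = p) → (∀ x y, f x y [] = p' x y) → (∀ x y, IsFlow n (f x y)) →
        IsFlow (n + 1) (fun l : List (X × Y) => match l with
          | [] => p
          | e :: l => f e.1 e.2 l) := by
      intro f p' p hp0 hp' hf hF
      constructor
      · rintro (_ | ⟨e, l⟩) hl
        · exact hp0
        · exact (hF _ _).nonneg l (by simpa using hl)
      · rintro (_ | ⟨e, l⟩) hl x
        · simp [hf, hp']
        · exact (hF _ _).sum_append l (by simpa using hl) x
    refine ⟨_, _, ?_, ?_, key f p' p hp0 hp' hf hfF, key g q' q hq0 hq' hg hgF, ?_⟩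
    · rfl
    · rfl
    · rintro (_ | ⟨e, l⟩) hl
      · rw [List.append_nil]
        exact ⟨hp.trans (capacity_le hP _ h hT), hq.trans (capacity_le hQ _ h hT), hpq, hqp⟩
      · have := hb e.1 e.2 l (by simpa using hl)
        simpa using this

end Systems

lemma Close.symm {Ω : Type u} {ε δ : ℝ} {p q : PMF Ω} (h : Close ε δ p q) : Close ε δ q p :=
  fun S => (h S).symm

lemma Close.mono {Ω : Type u} {ε ε' δ : ℝ} {p q : PMF Ω} (h : Close ε δ p q) (hε : ε ≤ ε') :
    Close ε' δ p q := fun S =>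
  have key (r : PMF Ω) : Real.exp ε * prob r S ≤ Real.exp ε' * prob r S :=
    mul_le_mul_of_nonneg_right (Real.exp_le_exp.2 hε) (prob_nonneg r S)
  ⟨(h S).1.trans (by linarith [key q]), (h S).2.trans (by linarith [key p])⟩

lemma IsDP.mono {D : Type w} {X : Type u} {Y : Type v} {adj : D → D → Prop} {ε ε' δ : ℝ}
    {M : Mechanism D X Y} (h : IsDP adj ε δ M) (hε : ε ≤ ε') : IsDP adj ε' δ M :=
  fun d d' hd A T => (h d d' hd A T).mono hε

/-! ### Simulation by randomized response -/

/-- Up to any number of rounds, each of two indistinguishable systems is a mixture of the same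
flows, with the weights of randomized response. -/
lemma Indistinguishable.exists_flows {X : Type u} {Y : Type v} [Fintype X] [Nonempty X] [Fintype Y]
    {ε δ : ℝ} (hε : 0 ≤ ε) (hδ1 : δ ≤ 1) {M₀ M₁ : InteractiveSystem X Y}
    (h : Indistinguishable ε δ M₀ M₁) (T : ℕ) :
    ∃ F : Outcome → List (X × Y) → ℝ, (∀ j, IsFlow T (F j)) ∧ (∀ j, F j [] = rrMass δ j) ∧
      ∀ l, l.length ≤ T → ∑ j, rrCoeff ε true j * F j l = likelihood M₀ l ∧
        ∑ j, rrCoeff ε false j * F j l = likelihood M₁ l := by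
  have ha : 1 ≤ Real.exp ε := Real.one_le_exp hε
  have hP := isFlow_likelihood M₀ T
  have hQ := isFlow_likelihood M₁ T
  have hle : 1 - δ ≤ Real.exp ε * (1 - δ) := by nlinarith
  obtain ⟨p, q, hp, hq, hpF, hqF, hpq⟩ := exists_subflows ha hP hQ T [] (by simp)
    (sub_nonneg.2 hδ1) (sub_nonneg.2 hδ1)
    (one_sub_le_capacity fun A S => (h A T S).1) (one_sub_le_capacity fun A S => (h A T S).2)
    hle hle
  simp only [List.nil_append] at hpq
  obtain ⟨α, β, hαβ, H⟩ := exists_rrParts_weights ha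
  refine ⟨fun j l => rrParts α β (likelihood M₀ l) (likelihood M₁ l) (p l) (q l) j,
    fun j => ⟨fun l hl => ?_, fun l hl x => ?_⟩, fun j => ?_, fun l hl => ?_⟩
  · obtain ⟨h1, h2, h3, h4⟩ := hpq l hl
    exact rrParts_nonneg H (hpF.nonneg l hl) (hqF.nonneg l hl) h1 h2 h3 h4 j
  · rw [sum_rrParts, hP.sum_append l hl, hQ.sum_append l hl, hpF.sum_append l hl,
      hqF.sum_append l hl]
  · simp only [likelihood_nil, hp, hq, rrParts_one hαβ]
  · obtain ⟨h1, h2, h3, h4⟩ := hpq l hl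
    exact sum_rrCoeff_mul_rrParts H (hpF.nonneg l hl) (hqF.nonneg l hl) h3 h4

lemma Close.one_sub_le_sum_min {R : Type*} [Fintype R] {ε δ : ℝ} {p q : PMF R}
    (h : Close ε δ p q) :
    1 - δ ≤ ∑ x, min (p x).toReal (Real.exp ε * (q x).toReal) := by
  classical
  have h1 := (h {x | Real.exp ε * (q x).toReal ≤ (p x).toReal}).1
  rw [prob_eq_sum_fintype, prob_eq_sum_fintype] at h1
  simp only [Set.mem_ofPred_eq, sum_filter, mul_sum] at h1
  rw [← sum_toReal_eq_one p]
  suffices ∑ x, (p x).toReal - ∑ x, min (p x).toReal (Real.exp ε * (q x).toReal) ≤ δ by linarith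
  refine le_trans (le_of_eq ?_) (sub_le_iff_le_add'.2 h1)
  rw [← sum_sub_distrib, ← sum_sub_distrib]
  refine sum_congr rfl fun x _ => ?_
  split_ifs with hc
  · rw [min_eq_right hc]
  · rw [min_eq_left (not_le.1 hc).le]; ring

/-- Two close distributions are mixtures of the same measures, with the weights of randomized
response. -/
lemma Close.exists_parts {R : Type*} [Fintype R] {ε δ : ℝ} (hε : 0 ≤ ε) (hδ1 : δ ≤ 1)
    {P Q : PMF R} (h : Close ε δ P Q) :
    ∃ F : Outcome → R → ℝ, (∀ j x, 0 ≤ F j x) ∧ (∀ j, ∑ x, F j x = rrMass δ j) ∧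
      ∀ x, ∑ j, rrCoeff ε true j * F j x = (P x).toReal ∧
        ∑ j, rrCoeff ε false j * F j x = (Q x).toReal := by
  have ha : 1 ≤ Real.exp ε := Real.one_le_exp hε
  have ha0 := (Real.exp_pos ε).le
  have hle : 1 - δ ≤ Real.exp ε * (1 - δ) := by nlinarith
  have hmin : ∀ x y : ℝ, 0 ≤ x → min x (Real.exp ε * y) ≤ Real.exp ε * min y (Real.exp ε * x) := by
    intro x y hx
    rw [mul_min_of_nonneg _ _ ha0]
    refine le_min (min_le_right _ _) ((min_le_left _ _).trans ?_)
    nlinarith [mul_nonneg (sub_nonneg.2 ha) hx, mul_nonneg (sub_nonneg.2 ha) (mul_nonneg ha0 hx)]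
  have h0 : ∀ (p : PMF R) (x : R), 0 ≤ (p x).toReal := fun _ _ => ENNReal.toReal_nonneg
  obtain ⟨p, q, hp, hq, H'⟩ := exists_split ha
    (s := fun x => min (P x).toReal (Real.exp ε * (Q x).toReal))
    (t := fun x => min (Q x).toReal (Real.exp ε * (P x).toReal))
    (fun x => le_min (h0 P x) (mul_nonneg ha0 (h0 Q x)))
    (fun x => le_min (h0 Q x) (mul_nonneg ha0 (h0 P x)))
    (fun x => hmin _ _ (h0 P x)) (fun x => hmin _ _ (h0 Q x))
    (sub_nonneg.2 hδ1) (sub_nonneg.2 hδ1) h.one_sub_le_sum_min h.symm.one_sub_le_sum_min hle hle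
  obtain ⟨α, β, hαβ, H⟩ := exists_rrParts_weights ha
  refine ⟨fun j x => rrParts α β (P x).toReal (Q x).toReal (p x) (q x) j,
    fun j x => ?_, fun j => ?_, fun x => ?_⟩
  · obtain ⟨h1, h2, h3, h4, h5, h6⟩ := H' x
    exact rrParts_nonneg H h1 h2 (h3.trans (min_le_left _ _)) (h4.trans (min_le_left _ _)) h5 h6 j
  · rw [sum_rrParts, sum_toReal_eq_one, sum_toReal_eq_one, hp, hq, rrParts_one hαβ]
  · obtain ⟨h1, h2, h3, h4, h5, h6⟩ := H' x
    exact sum_rrCoeff_mul_rrParts H h1 h2 h5 h6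

lemma prod_sum_mul {k : ℕ} (c f : Fin k → Outcome → ℝ) :
    ∏ i, ∑ j, c i j * f i j = ∑ r : Fin k → Outcome, (∏ i, c i (r i)) * ∏ i, f i (r i) := by
  rw [Fintype.prod_sum]
  simp only [prod_mul_distrib]

/-! ### Concurrent composition -/

section Comp

variable {k : ℕ} {X : Type u} {Y : Type v}

lemma view_append (i : Fin k) (h : List ((Fin k × X) × Y)) (e : (Fin k × X) × Y) :
    view i (h ++ [e]) = view i h ++ if e.1.1 = i then [(e.1.2, e.2)] else [] := by
  rw [view, List.filterMap_append]
  congr 1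
  split_ifs with hi <;> simp [hi]

lemma length_view_le (i : Fin k) (h : List ((Fin k × X) × Y)) :
    (view i h).length ≤ h.length := List.length_filterMap_le _ _

lemma prod_view_append (F : Fin k → List (X × Y) → ℝ) (h : List ((Fin k × X) × Y))
    (e : (Fin k × X) × Y) :
    ∏ i, F i (view i (h ++ [e])) =
      F e.1.1 (view e.1.1 h ++ [(e.1.2, e.2)]) * ∏ i ∈ univ.erase e.1.1, F i (view i h) := by
  rw [← mul_prod_erase univ _ (mem_univ e.1.1), view_append, if_pos rfl]
  congr 1
  refine prod_congr rfl fun i hi => ?_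
  rw [view_append, if_neg (ne_of_mem_erase hi).symm, List.append_nil]

/-- Each new response affects a single view, hence a single factor. -/
lemma likelihood_comp (M : Fin k → InteractiveSystem X Y) (h : List ((Fin k × X) × Y)) :
    likelihood (comp M) h = ∏ i, likelihood (M i) (view i h) := by
  induction h using List.reverseRecOn with
  | nil => simp [view]
  | append_singleton h e ih =>
    rw [prod_view_append (fun i => likelihood (M i)), likelihood_append, likelihood_append, ih,
      ← mul_prod_erase univ _ (mem_univ e.1.1), comp]
    ring

lemma IsFlow.comp [Fintype Y] {T : ℕ} {F : Fin k → List (X × Y) → ℝ}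
    (hF : ∀ i, IsFlow T (F i)) : IsFlow T fun h => ∏ i, F i (view i h) where
  nonneg h hT := prod_nonneg fun i _ => (hF i).nonneg _ ((length_view_le i h).trans hT)
  sum_append h hT := by
    rintro ⟨i, x⟩
    simp only [prod_view_append]
    rw [← sum_mul, (hF i).sum_append _ ((length_view_le i h).trans_lt hT),
      mul_prod_erase univ (fun i => F i (view i h)) (mem_univ i)]

variable {ε δ : Fin k → ℝ} {ε' δ' : ℝ}

lemma OptimalCondition.prob_transcript_comp_le [Finite X] [Finite Y]
    (hε : ∀ i, 0 ≤ ε i) (hδ : ∀ i, 0 ≤ δ i ∧ δ i ≤ 1) (hopt : OptimalCondition ε δ ε' δ')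
    {M₀ M₁ : Fin k → InteractiveSystem X Y} (h : ∀ i, Indistinguishable (ε i) (δ i) (M₀ i) (M₁ i))
    (A : Adversary (Fin k × X) Y) (T : ℕ) (S : Set (List ((Fin k × X) × Y))) :
    prob (transcript A (comp M₀) T) S ≤
      Real.exp ε' * prob (transcript A (comp M₁) T) S + δ' := by
  classical
  -- The adversary must ask something, so `X` is nonempty, as the infimum in `capacity` requires.
  obtain ⟨⟨-, x⟩, -⟩ := (A []).support_nonempty
  have : Nonempty X := ⟨x⟩
  cases nonempty_fintype X
  cases nonempty_fintype Y
  choose F hF hF1 hFM using fun i => (h i).exists_flows (hε i) (hδ i).2 T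
  have hflow := fun r : Fin k → Outcome => IsFlow.comp fun i => hF i (r i)
  have key : ∀ (b : Bool) (M : Fin k → InteractiveSystem X Y),
      (∀ i l, l.length ≤ T → ∑ j, rrCoeff (ε i) b j * F i j l = likelihood (M i) l) →
      prob (transcript A (comp M) T) S = ∑ r : Fin k → Outcome, (∏ i, rrCoeff (ε i) b (r i)) *
        ∑ h ∈ histories (Fin k × X) Y T with h ∈ S,
          advLikelihood A h * ∏ i, F i (r i) (view i h) := by
    intro b M hM
    rw [prob_transcript]
    simp only [mul_sum]
    rw [sum_comm]
    refine sum_congr rfl fun l hl => ?_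
    have hlT := mem_histories.1 (mem_filter.1 hl).1
    rw [likelihood_comp, ← prod_congr rfl fun i _ =>
      hM i (view i l) ((length_view_le i l).trans hlT.le), prod_sum_mul, mul_sum]
    exact sum_congr rfl fun r _ => by ring
  rw [key true M₀ fun i l hl => (hFM i l hl).1, key false M₁ fun i l hl => (hFM i l hl).2]
  have hnonneg : ∀ (r : Fin k → Outcome), ∀ h ∈ histories (Fin k × X) Y T,
      0 ≤ advLikelihood A h * ∏ i, F i (r i) (view i h) := fun r l hl =>
    mul_nonneg (advLikelihood_nonneg A l) ((hflow r).nonneg l (mem_histories.1 hl).le)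
  refine hopt.mixture_le (fun r => sum_nonneg fun l hl => hnonneg r l (mem_filter.1 hl).1)
    fun r => ?_
  refine (sum_le_sum_of_subset_of_nonneg (filter_subset _ _)
    fun l hl _ => hnonneg r l hl).trans_eq ?_
  -- The total mass of a flow is its root value, whatever the adversary does.
  rw [(hflow r).sum_advLikelihood_mul A]
  exact prod_congr rfl fun i _ => hF1 i (r i)

lemma Indistinguishable.symm {ε δ : ℝ} {M₀ M₁ : InteractiveSystem X Y}
    (h : Indistinguishable ε δ M₀ M₁) : Indistinguishable ε δ M₁ M₀ := fun A T => (h A T).symm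

theorem OptimalCondition.isDP_compMech [Finite X] [Finite Y]
    (hε : ∀ i, 0 ≤ ε i) (hδ : ∀ i, 0 ≤ δ i ∧ δ i ≤ 1) (hopt : OptimalCondition ε δ ε' δ')
    {D : Type w} {adj : D → D → Prop} {M : Fin k → Mechanism D X Y}
    (hM : ∀ i, IsDP adj (ε i) (δ i) (M i)) : IsDP adj ε' δ' (compMech M) :=
  fun d d' hd A T S =>
    ⟨hopt.prob_transcript_comp_le hε hδ (fun i => hM i d d' hd) A T S,
      hopt.prob_transcript_comp_le hε hδ (fun i => (hM i d d' hd).symm) A T S⟩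

end Comp

/-! ### Sequential composition -/

section Sequential

variable {k : ℕ} {ε δ : Fin k → ℝ} {ε' δ' : ℝ}

lemma toReal_prodPMF_apply {R : Fin k → Type} [∀ i, Fintype (R i)] (p : ∀ i, PMF (R i))
    (x : ∀ i, R i) : (prodPMF p x).toReal = ∏ i, (p i (x i)).toReal := by
  rw [prodPMF, PMF.ofFintype_apply, ENNReal.toReal_prod]

lemma OptimalCondition.prob_prodPMF_le
    (hε : ∀ i, 0 ≤ ε i) (hδ : ∀ i, 0 ≤ δ i ∧ δ i ≤ 1) (hopt : OptimalCondition ε δ ε' δ')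
    {R : Fin k → Type} [∀ i, Fintype (R i)] {p q : ∀ i, PMF (R i)}
    (h : ∀ i, Close (ε i) (δ i) (p i) (q i)) (S : Set (∀ i, R i)) :
    prob (prodPMF p) S ≤ Real.exp ε' * prob (prodPMF q) S + δ' := by
  classical
  choose F hF0 hF1 hFM using fun i => (h i).exists_parts (hε i) (hδ i).2
  have key : ∀ (b : Bool) (p : ∀ i, PMF (R i)),
      (∀ i x, ∑ j, rrCoeff (ε i) b j * F i j x = (p i x).toReal) →
      prob (prodPMF p) S = ∑ r : Fin k → Outcome, (∏ i, rrCoeff (ε i) b (r i)) *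
        ∑ x with x ∈ S, ∏ i, F i (r i) (x i) := by
    intro b p hp
    rw [prob_eq_sum_fintype]
    simp only [mul_sum]
    rw [sum_comm]
    refine sum_congr rfl fun x _ => ?_
    rw [toReal_prodPMF_apply, ← prod_congr rfl fun i _ => hp i (x i), prod_sum_mul]
  rw [key true p fun i x => (hFM i x).1, key false q fun i x => (hFM i x).2]
  have hnonneg : ∀ (r : Fin k → Outcome) (x : ∀ i, R i), 0 ≤ ∏ i, F i (r i) (x i) :=
    fun r x => prod_nonneg fun i _ => hF0 i (r i) (x i)
  refine hopt.mixture_le (fun r => sum_nonneg fun x _ => hnonneg r x) fun r => ?_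
  refine (sum_le_sum_of_subset_of_nonneg (filter_subset _ _)
    fun x _ _ => hnonneg r x).trans_eq ?_
  rw [← Fintype.prod_sum (fun i x => F i (r i) x)]
  exact prod_congr rfl fun i _ => hF1 i (r i)

theorem OptimalCondition.sequentialBound
    (hε : ∀ i, 0 ≤ ε i) (hδ : ∀ i, 0 ≤ δ i ∧ δ i ≤ 1) (hopt : OptimalCondition ε δ ε' δ') :
    SequentialBound ε δ ε' δ' :=
  fun _ _ _ _ _ hN d d' hd S =>
    ⟨hopt.prob_prodPMF_le hε hδ (fun i => hN i d d' hd) S,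
      hopt.prob_prodPMF_le hε hδ (fun i => (hN i d d' hd).symm) S⟩

/-- `(ε, δ)`-randomized response. -/
def randomizedResponse (ε δ : ℝ) (h0 : 0 ≤ δ) (h1 : δ ≤ 1) (b : Bool) : PMF Outcome :=
  PMF.ofFintype (fun j => ENNReal.ofReal (rrCoeff ε b j * rrMass δ j)) (by
    rw [← ENNReal.ofReal_sum_of_nonneg fun j _ =>
      mul_nonneg (rrCoeff_nonneg ε b j) (rrMass_nonneg h0 h1 j), sum_rrCoeff_mul_rrMass,
      ENNReal.ofReal_one])

lemma toReal_randomizedResponse_apply {ε δ : ℝ} (h0 : 0 ≤ δ) (h1 : δ ≤ 1) (b : Bool)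
    (j : Outcome) :
    (randomizedResponse ε δ h0 h1 b j).toReal = rrCoeff ε b j * rrMass δ j := by
  rw [randomizedResponse, PMF.ofFintype_apply, ENNReal.toReal_ofReal
    (mul_nonneg (rrCoeff_nonneg ε b j) (rrMass_nonneg h0 h1 j))]

lemma close_randomizedResponse {ε δ : ℝ} (hε : 0 ≤ ε) (h0 : 0 ≤ δ) (h1 : δ ≤ 1) (b b' : Bool) :
    Close ε δ (randomizedResponse ε δ h0 h1 b) (randomizedResponse ε δ h0 h1 b') := by
  classical
  suffices ∀ b b' S, prob (randomizedResponse ε δ h0 h1 b) S ≤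
      Real.exp ε * prob (randomizedResponse ε δ h0 h1 b') S + δ from
    fun S => ⟨this b b' S, this b' b S⟩
  intro b b' S
  have ha : 1 ≤ Real.exp ε := Real.one_le_exp hε
  have ha0 := Real.exp_pos ε
  rw [prob_eq_sum_fintype, prob_eq_sum_fintype]
  simp only [toReal_randomizedResponse_apply]
  -- The slack `δ` is needed only for the outcome revealing `b`; all others obey the pure ratio `e ^
  -- ε`.
  have hsum : ∑ j ∈ (univ.filter (· ∈ S)), (if j = Sum.inl b then δ else 0) ≤ δ := by
    rw [sum_ite_eq']
    split_ifs <;> simp [h0]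
  refine le_trans ?_ (add_le_add_right hsum _)
  rw [mul_sum, ← sum_add_distrib]
  refine sum_le_sum fun j _ => ?_
  rcases j with c | c
  · have := rrCoeff_nonneg ε b' (Sum.inl c)
    by_cases hc : c = b
    · simp only [rrCoeff, hc, rrMass]
      split_ifs <;> simp <;> positivity
    · simp only [rrCoeff, hc, rrMass]
      split_ifs <;> simp_all
  · have h1' : 0 ≤ 1 - δ := sub_nonneg.2 h1
    simp only [rrMass, reduceCtorEq, if_false, add_zero, ← mul_assoc]
    refine mul_le_mul_of_nonneg_right ?_ h1'
    simp only [rrCoeff, ← mul_div_assoc]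
    gcongr
    split_ifs <;> nlinarith

/-- Randomized response on adjacent bits, with the likelihood ratio test as event, turns the bound
into the condition. -/
theorem SequentialBound.optimalCondition
    (hε : ∀ i, 0 ≤ ε i) (hδ : ∀ i, 0 ≤ δ i ∧ δ i ≤ 1) (h : SequentialBound ε δ ε' δ') :
    OptimalCondition ε δ ε' δ' := by
  classical
  have h1 := (h Bool (fun _ _ => True) (fun _ => Outcome)
    (fun i => randomizedResponse (ε i) (δ i) (hδ i).1 (hδ i).2)
    (fun i d d' _ => close_randomizedResponse (hε i) _ _ d d') true false trivial
    {r | Real.exp ε' * ∏ i, rrCoeff (ε i) false (r i) ≤ ∏ i, rrCoeff (ε i) true (r i)}).1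
  rw [prob_eq_sum_fintype, prob_eq_sum_fintype] at h1
  simp only [Set.mem_ofPred_eq, sum_filter, mul_sum, toReal_prodPMF_apply,
    toReal_randomizedResponse_apply, prod_mul_distrib] at h1
  rw [optimalCondition_iff, ← sum_prod_rrCoeff_mul_prod_rrMass ε δ true]
  refine sub_le_comm.1 (le_trans (le_of_eq ?_) (sub_le_iff_le_add'.2 h1))
  rw [← sum_sub_distrib, ← sum_sub_distrib]
  refine sum_congr rfl fun r _ => ?_
  split_ifs with hc
  · rw [min_eq_right hc]; ring
  · rw [min_eq_left (not_le.1 hc).le]; ring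

end Sequential

/-! ### Equal parameters -/

/-- Hoeffding's lemma for the privacy loss of randomized response. -/
lemma privacyLoss_mgf_le {ε : ℝ} (hε : 0 ≤ ε) (t : ℝ) :
    (Real.exp (ε * (1 + t)) + Real.exp (-(ε * t))) / (1 + Real.exp ε) ≤
      Real.exp (t * (ε * ((Real.exp ε - 1) / (Real.exp ε + 1))) + ε ^ 2 * t ^ 2 / 2) := by
  have hpos : 0 < 1 + Real.exp ε := by positivity
  set c : Bool → ℝ := fun b => (if b then Real.exp ε else 1) / (1 + Real.exp ε) with hc
  have hc0 : ∀ b, 0 ≤ c b := fun b => by simp only [hc]; split_ifs <;> positivity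
  set m := ε * ((Real.exp ε - 1) / (Real.exp ε + 1)) with hm
  let p : PMF Bool := PMF.ofFintype (fun b => ENNReal.ofReal (c b)) (by
    rw [← ENNReal.ofReal_sum_of_nonneg fun b _ => hc0 b, ENNReal.ofReal_eq_one]
    simp [hc]
    field_simp
    ring)
  have hint : ∀ f : Bool → ℝ, ∫ b, f b ∂p.toMeasure = c true * f true + c false * f false := by
    intro f
    rw [PMF.integral_eq_sum]
    simp [p, PMF.ofFintype_apply, ENNReal.toReal_ofReal (hc0 _)]
  have hmean : ∫ b : Bool, (if b then ε else -ε) ∂p.toMeasure = m := by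
    rw [hint]
    simp [hc, hm]
    field_simp
    ring
  have hH := (ProbabilityTheory.hasSubgaussianMGF_of_mem_Icc (μ := p.toMeasure)
    (X := fun b : Bool => if b then ε else -ε) (a := -ε) (b := ε)
    (measurable_of_countable _).aemeasurable
    (Filter.Eventually.of_forall fun b => by
      cases b <;> simp <;> linarith)).mgf_le t
  rw [hmean, ProbabilityTheory.mgf, hint] at hH
  -- The loss is `ε` or `-ε`, so Hoeffding's variance proxy is the squared half-length `ε ^ 2`.
  have hn : (((‖ε - -ε‖₊ / 2) ^ 2 : NNReal) : ℝ) = ε ^ 2 := by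
    push_cast
    rw [Real.norm_eq_abs, abs_of_nonneg (by linarith)]
    ring
  rw [hn] at hH
  have hmul := mul_le_mul_of_nonneg_left hH (Real.exp_pos (t * m)).le
  rw [← Real.exp_add] at hmul
  refine le_trans (le_of_eq ?_) hmul
  have e1 : Real.exp (ε * (1 + t)) = Real.exp (t * m) * (Real.exp ε * Real.exp (t * (ε - m))) := by
    rw [← Real.exp_add, ← Real.exp_add]; ring_nf
  have e2 : Real.exp (-(ε * t)) = Real.exp (t * m) * Real.exp (t * (-ε - m)) := by
    rw [← Real.exp_add]; ring_nf
  rw [e1, e2]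
  simp [hc]
  field_simp

lemma card_compl_eq {k : ℕ} (S : Finset (Fin k)) : #Sᶜ = k - #S := by
  rw [card_compl, Fintype.card_fin]

/-- The Chernoff bound for the total privacy loss of `k` instances of randomized response. -/
lemma sum_max_le_exp {k : ℕ} {ε : ℝ} (hε : 0 ≤ ε) (ε' : ℝ) {t : ℝ} (ht : 0 ≤ t) :
    (∑ S : Finset (Fin k),
      max (Real.exp (∑ _ ∈ S, ε) - Real.exp ε' * Real.exp (∑ _ ∈ Sᶜ, ε)) 0) /
        ∏ _ : Fin k, (1 + Real.exp ε) ≤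
      Real.exp (k * (t * (ε * ((Real.exp ε - 1) / (Real.exp ε + 1))) + ε ^ 2 * t ^ 2 / 2)
        - t * ε') := by
  have hterm : ∀ S : Finset (Fin k),
      max (Real.exp (∑ _ ∈ S, ε) - Real.exp ε' * Real.exp (∑ _ ∈ Sᶜ, ε)) 0 ≤
        Real.exp (-(t * ε')) * (Real.exp (ε * (1 + t)) ^ #S * Real.exp (-(ε * t)) ^ (k - #S)) := by
    intro S
    refine max_le ?_ (by positivity)
    rw [← card_compl_eq]
    set a : ℝ := ∑ i ∈ S, ε with ha
    set b : ℝ := ∑ i ∈ Sᶜ, ε with hb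
    have hr : Real.exp (-(t * ε')) * (Real.exp (ε * (1 + t)) ^ #S * Real.exp (-(ε * t)) ^ #Sᶜ) =
        Real.exp (a + t * (a - b - ε')) := by
      rw [← Real.exp_nat_mul, ← Real.exp_nat_mul, ← Real.exp_add, ← Real.exp_add, ha, hb,
        sum_const, sum_const, nsmul_eq_mul, nsmul_eq_mul]
      ring_nf
    rw [hr, ← Real.exp_add]
    -- If the loss `a - b` is at most `ε'`, the difference is nonpositive; otherwise the exponential
    -- tilt is at least one.
    rcases le_total (a - b - ε') 0 with h | h
    · have : Real.exp a ≤ Real.exp (ε' + b) := Real.exp_le_exp.2 (by linarith)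
      linarith [Real.exp_pos (a + t * (a - b - ε'))]
    · have : Real.exp a ≤ Real.exp (a + t * (a - b - ε')) :=
        Real.exp_le_exp.2 (by nlinarith [mul_nonneg ht h])
      linarith [Real.exp_pos (ε' + b)]
  have hpow := Fintype.sum_pow_mul_eq_add_pow (Fin k) (Real.exp (ε * (1 + t)))
    (Real.exp (-(ε * t)))
  rw [Fintype.card_fin] at hpow
  calc _ ≤ (Real.exp (-(t * ε')) * (Real.exp (ε * (1 + t)) + Real.exp (-(ε * t))) ^ k) /
        ∏ _ : Fin k, (1 + Real.exp ε) := by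
        rw [← hpow, mul_sum]
        exact div_le_div_of_nonneg_right (sum_le_sum fun S _ => hterm S)
          (prod_nonneg fun _ _ => by positivity)
    _ = Real.exp (-(t * ε')) *
        ((Real.exp (ε * (1 + t)) + Real.exp (-(ε * t))) / (1 + Real.exp ε)) ^ k := by
        rw [prod_const, card_univ, Fintype.card_fin, div_pow, mul_div_assoc]
    _ ≤ Real.exp (-(t * ε')) * Real.exp (t * (ε * ((Real.exp ε - 1) / (Real.exp ε + 1))) +
        ε ^ 2 * t ^ 2 / 2) ^ k :=
        mul_le_mul_of_nonneg_left (pow_le_pow_left₀ (by positivity) (privacyLoss_mgf_le hε t) k)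
          (Real.exp_pos _).le
    _ = _ := by
        rw [← Real.exp_nat_mul, ← Real.exp_add]
        ring_nf

lemma sum_max_le {k : ℕ} {ε δ' : ℝ} (hε : 0 ≤ ε) (h0 : 0 < δ') (h1 : δ' < 1) :
    (∑ S : Finset (Fin k), max (Real.exp (∑ _ ∈ S, ε) -
      Real.exp (√(2 * k * Real.log (1 / δ')) * ε + k * ε * ((Real.exp ε - 1) / (Real.exp ε + 1))) *
        Real.exp (∑ _ ∈ Sᶜ, ε)) 0) / ∏ _ : Fin k, (1 + Real.exp ε) ≤ δ' := by
  have hL : 0 ≤ Real.log (1 / δ') := Real.log_nonneg (by rw [le_div_iff₀ h0]; linarith)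
  rcases hε.eq_or_lt with rfl | hε'
  · simp [h0.le]
  rcases k.eq_zero_or_pos with rfl | hk
  · rw [Fintype.sum_subsingleton _ ∅]
    simp [h0.le]
  have hk' : (0 : ℝ) < k := by exact_mod_cast hk
  -- With `s` the square root, the exponent is `k ε² t² / 2 - t s ε`, minimal at `t = s / (k ε)`
  -- with value `-s² / (2k) = log δ'`.
  refine (sum_max_le_exp hε _ (t := √(2 * k * Real.log (1 / δ')) / (k * ε))
    (by positivity)).trans ?_
  have hs : √(2 * k * Real.log (1 / δ')) ^ 2 = 2 * k * Real.log (1 / δ') :=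
    Real.sq_sqrt (by positivity)
  set s := √(2 * k * Real.log (1 / δ'))
  rw [← Real.le_log_iff_exp_le h0]
  refine le_of_eq ?_
  have hlog : Real.log δ' = -Real.log (1 / δ') := by
    rw [one_div, Real.log_inv, neg_neg]
  rw [hlog]
  calc _ = -(s ^ 2 / (2 * k)) := by
        field_simp
        ring
    _ = _ := by
        rw [hs]
        field_simp

lemma optimalCondition_const {k : ℕ} {ε δ δ' : ℝ} (hε : 0 ≤ ε) (hδ0 : 0 ≤ δ) (hδ1 : δ ≤ 1)
    (h0 : 0 < δ') (h1 : δ' < 1) :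
    OptimalCondition (fun _ : Fin k => ε) (fun _ => δ)
      (√(2 * k * Real.log (1 / δ')) * ε + k * ε * ((Real.exp ε - 1) / (Real.exp ε + 1)))
      (k * δ + δ') := by
  have hH := sum_max_le (k := k) hε h0 h1
  rw [OptimalCondition, prod_const, card_univ, Fintype.card_fin]
  have hpow : 0 ≤ (1 - δ) ^ k := pow_nonneg (sub_nonneg.2 hδ1) k
  refine le_trans ?_ (mul_le_mul_of_nonneg_left (sub_le_sub_left hH 1) hpow)
  -- Bernoulli's inequality; then `(1 - kδ)(1 - δ') ≥ 1 - kδ - δ'`.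
  have hB : 1 - k * δ ≤ (1 - δ) ^ k := by
    have := one_add_mul_le_pow (a := -δ) (by linarith) k
    rw [← sub_eq_add_neg] at this
    linarith
  have hkδ : 0 ≤ k * δ := by positivity
  nlinarith [mul_le_mul_of_nonneg_right hB (sub_nonneg.2 h1.le)]

lemma tanh_half_le {ε : ℝ} (hε : 0 ≤ ε) : (Real.exp ε - 1) / (Real.exp ε + 1) ≤ ε := by
  rw [div_le_iff₀ (by positivity)]
  have h1 := Real.add_one_le_exp (-ε)
  have h2 : Real.exp ε * Real.exp (-ε) = 1 := by rw [← Real.exp_add]; simp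
  nlinarith [Real.exp_pos ε]

/-- In this regime the drift, at most `k ε²`, is of the order of the deviation term: `(k ε)² ≤ c k
L`. -/
lemma explicit_bound_le {k : ℕ} {ε L c : ℝ} (hε : 0 ≤ ε) (hc : 0 ≤ c)
    (h : k * ε ^ 2 ≤ c * L) :
    √(2 * k * L) * ε + k * ε * ((Real.exp ε - 1) / (Real.exp ε + 1)) ≤
      (√2 + √c) * √(k * L) * ε := by
  have h1 : k * ε * ((Real.exp ε - 1) / (Real.exp ε + 1)) ≤ k * ε * ε :=
    mul_le_mul_of_nonneg_left (tanh_half_le hε) (by positivity)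
  have h2 : k * ε ≤ √c * √(k * L) := by
    rw [← Real.sqrt_mul hc]
    refine Real.le_sqrt_of_sq_le ?_
    have := mul_le_mul_of_nonneg_left h (Nat.cast_nonneg (α := ℝ) k)
    linarith
  have h3 : √(2 * k * L) = √2 * √(k * L) := by
    rw [mul_assoc, Real.sqrt_mul zero_le_two]
  rw [h3]
  nlinarith [mul_le_mul_of_nonneg_right h2 hε]

end ConcurrentDP

end

theorem theorem1 :
    -- The optimal parameters: validity for sequential composition is the explicit condition.
    (∀ (k : ℕ) (ε δ : Fin k → ℝ), (∀ i, 0 ≤ ε i) → (∀ i, 0 ≤ δ i ∧ δ i ≤ 1) →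
      ∀ ε' δ' : ℝ, SequentialBound ε δ ε' δ' ↔ OptimalCondition ε δ ε' δ') ∧
    -- Concurrent composition has all these parameters.
    (∀ (k : ℕ) (ε δ : Fin k → ℝ), (∀ i, 0 ≤ ε i) → (∀ i, 0 ≤ δ i ∧ δ i ≤ 1) →
      ∀ (D : Type w) (adj : D → D → Prop) (X : Type u) (Y : Type v) [Finite X] [Finite Y]
        (M : Fin k → Mechanism D X Y), (∀ i, IsDP adj (ε i) (δ i) (M i)) →
      ∀ ε' δ' : ℝ, OptimalCondition ε δ ε' δ' → IsDP adj ε' δ' (compMech M)) ∧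
    -- Equal parameters, explicit bound.
    (∀ (k : ℕ) (ε δ δ' : ℝ), 0 ≤ ε → 0 ≤ δ → δ ≤ 1 → 0 < δ' → δ' < 1 →
      ∀ (D : Type w) (adj : D → D → Prop) (X : Type u) (Y : Type v) [Finite X] [Finite Y]
        (M : Fin k → Mechanism D X Y), (∀ i, IsDP adj ε δ (M i)) →
      IsDP adj
        (√(2 * k * Real.log (1 / δ')) * ε + k * ε * ((Real.exp ε - 1) / (Real.exp ε + 1)))
        (k * δ + δ') (compMech M)) ∧
    -- Equal parameters, asymptotic bound.
    (∀ c : ℝ, 0 < c → ∃ C : ℝ, 0 < C ∧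
      ∀ (k : ℕ) (ε δ δ' : ℝ), 0 ≤ ε → 0 ≤ δ → δ ≤ 1 → 0 < δ' → δ' < 1 →
        k * ε ^ 2 ≤ c * Real.log (1 / δ') →
      ∀ (D : Type w) (adj : D → D → Prop) (X : Type u) (Y : Type v) [Finite X] [Finite Y]
        (M : Fin k → Mechanism D X Y), (∀ i, IsDP adj ε δ (M i)) →
      IsDP adj (C * √(k * Real.log (1 / δ')) * ε) (k * δ + δ') (compMech M)) := by
  refine ⟨fun k ε δ hε hδ ε' δ' => ⟨fun h => h.optimalCondition hε hδ,
      fun h => h.sequentialBound hε hδ⟩,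
    fun k ε δ hε hδ D adj X Y _ _ M hM ε' δ' h => h.isDP_compMech hε hδ hM,
    fun k ε δ δ' hε hδ0 hδ1 h0 h1 D adj X Y _ _ M hM =>
      (optimalCondition_const hε hδ0 hδ1 h0 h1).isDP_compMech (fun _ => hε)
        (fun _ => ⟨hδ0, hδ1⟩) hM,
    fun c hc => ⟨√2 + √c, by positivity, ?_⟩⟩
  intro k ε δ δ' hε hδ0 hδ1 h0 h1 h D adj X Y _ _ M hM
  exact ((optimalCondition_const hε hδ0 hδ1 h0 h1).isDP_compMech (fun _ => hε)
    (fun _ => ⟨hδ0, hδ1⟩) hM).mono (explicit_bound_le hε hc.le h)
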